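/- Setting. A network is a finite simple undirected graph $G=(V,E)$ (not necessarily connected) with edge weights $\omega(u,v)>0$ (real numbers) and a distinguished root $r\in V$. Each process $u$ has an injective labeling of its neighbors by elements of a set $Lbl$, and each neighbor knows the label it has at $u$; $\Gamma(u)$ denotes the set of labels of the neighbors of $u$, and a neighbor is identified with its label. Each process $u\ne r$ has variables $\mathrm{st}_u\in\{I,C,EB,EF\}$, $\mathrm{par}_u\in Lbl$, $d_u\in\mathbb R_{\ge 0}$; the root has the constants $\mathrm{st}_r=C$, $\mathrm{par}_r=\perp\notin Lbl$, $d_r=0$. A configuration is an assignment of values to all variables. Algorithm RSP. Let - $\mathrm{children}(u)=\{v\in\Gamma(u)\mid \mathrm{st}_u\ne I\wedge \mathrm{st}_v\ne I\wedge \mathrm{par}_v=u\wedge d_v\ge d_u+\omega(v,u)\wedge(\mathrm{st}_v=\mathrm{st}_u\vee \mathrm{st}_u=EB)\}$; - $\mathrm{abRoot}(u)\equiv \mathrm{st}_u\ne I\wedge[\mathrm{par}_u\notin\Gamma(u)\vee \mathrm{st}_{\mathrm{par}_u}=I\vee d_u<d_{\mathrm{par}_u}+\omega(u,\mathrm{par}_u)\vee(\mathrm{st}_u\ne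 \mathrm{st}_{\mathrm{par}_u}\wedge \mathrm{st}_{\mathrm{par}_u}\ne EB)]$; - $\mathrm{P\_reset}(u)\equiv \mathrm{st}_u=EF\wedge \mathrm{abRoot}(u)$; - $\mathrm{P\_correction}(u)\equiv\exists v\in\Gamma(u):\ \mathrm{st}_v=C\wedge d_v+\omega(u,v)<d_u$; - $\mathrm{computePath}(u)$: set $\mathrm{par}_u$ to a $v\in\Gamma(u)$ with $\mathrm{st}_v=C$ minimizing $d_v+\omega(u,v)$ (ties broken arbitrarily), then $d_u:=d_{\mathrm{par}_u}+\omega(u,\mathrm{par}_u)$ and $\mathrm{st}_u:=C$. The root has no rule. Each process $u\neq r$ has the rules - $R_C$: if $\mathrm{st}_u=C\wedge \mathrm{P\_correction}(u)$, then $\mathrm{computePath}(u)$; - $R_{EB}$: if $\mathrm{st}_u=C\wedge\neg \mathrm{P\_correction}(u)\wedge(\mathrm{abRoot}(u)\vee \mathrm{st}_{\mathrm{par}_u}=EB)$, then $\mathrm{st}_u:=EB$; - $R_{EF}$: if $\mathrm{st}_u=EB\wedge\forall v\in\mathrm{children}(u):\ \mathrm{st}_v=EF$, then $\mathrm{st}_u:=EF$;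 - $R_I$: if $\mathrm{P\_reset}(u)\wedge\forall v\in\Gamma(u):\ \mathrm{st}_v\ne C$, then $\mathrm{st}_u:=I$; - $R_R$: if $(\mathrm{P\_reset}(u)\vee \mathrm{st}_u=I)\wedge\exists v\in\Gamma(u):\ \mathrm{st}_v=C$, then $\mathrm{computePath}(u)$. Executions and rounds. A process is enabled in a configuration if the condition of one of its rules holds. A step $\gamma\mapsto\gamma'$ selects an arbitrary nonempty set of enabled processes, each of which atomically executes one of its enabled rules (distributed unfair daemon). An execution is a sequence of configurations $\gamma_0,\gamma_1,\dots$, with arbitrary $\gamma_0$ and $\gamma_{i}\mapsto\gamma_{i+1}$ for all $i$, that is maximal: either infinite or ending in a terminal configuration, i.e. one in which no process is enabled. A process is neutralized in a step $\gamma_i\mapsto\gamma_{i+1}$ if it is enabled in $\gamma_i$ but not in $\gamma_{i+1}$. The first round of an execution is its minimal prefix $\gamma_0,\dots,\gamma_j$ such that every process enabled in $\gamma_0$ executes a rule or is neutralized during some step of this prefix; the second round is the first round of the suffix $\gamma_j,\gamma_{j+1},\dots$, and so on. Parameters. Let $n_{\mathrm{maxCC}}$ be the maximum number of non-root processes in a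 connected component of $G$, and $V_r$ the connected component of $r$. A shortest path between two processes is a path of minimum weight (sum of its edge weights), and the hop-distance between two processes is the minimum number of edges in a shortest path between them. Let $D$ be the hop-diameter of $V_r$: the maximum hop-distance between two processes of $V_r$. Theorem. Every execution of Algorithm RSP lasts at most $3\,n_{\mathrm{maxCC}}+D$ rounds: it is finite, and its terminal configuration is reached by the end of round $3\,n_{\mathrm{maxCC}}+D$ at the latest. -/

import Mathlib

open scoped NNReal

namespace RSP

/-- A rooted network: a simple undirected graph with strictly positive edge weights, a
distinguished root, and, for every process `u`, a local labeling of its neighbors by elements of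
the datatype `Lbl` (distinct neighbors have distinct labels). The set of labels `Γ(u)` is the range
of `label u`. -/
structure Network (V Lbl : Type*) where
  graph : SimpleGraph V
  weight : Sym2 V → ℝ≥0
  weight_pos : ∀ e ∈ graph.edgeSet, 0 < weight e
  root : V
  label : ∀ u : V, graph.neighborSet u ↪ Lbl

/-- The four possible statuses: isolated, correct, error broadcast, error feedback. -/
inductive Status
  | I
  | C
  | EB
  | EF

/-- The local variables `st`, `par`, `d` of a non-root process. -/
structure State (Lbl : Type*) where
  st : Status
  par : Lbl
  d : ℝ≥0

namespace Network

variable {V Lbl : Type*} (N : Network V Lbl)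

/-- The weight of a walk: the sum of the weights of its edges. -/
def walkWeight {u v : V} (p : N.graph.Walk u v) : ℝ≥0 :=
  (p.edges.map N.weight).sum

/-- A shortest path is a path of minimum weight. -/
def IsShortestPath {u v : V} (p : N.graph.Walk u v) : Prop :=
  p.IsPath ∧ ∀ q : N.graph.Walk u v, q.IsPath → N.walkWeight p ≤ N.walkWeight q

/-- The hop-distance: the minimum number of edges in a shortest (i.e. minimum-weight) path. -/
noncomputable def hopDist (u v : V) : ℕ :=
  sInf {k : ℕ | ∃ p : N.graph.Walk u v, N.IsShortestPath p ∧ p.length = k}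

/-- The connected component `V_r` of the root. -/
def rootComponent : N.graph.ConnectedComponent :=
  N.graph.connectedComponentMk N.root

/-- The hop-diameter of the connected component of the root. -/
noncomputable def hopDiam : ℕ :=
  ⨆ p : N.rootComponent.supp × N.rootComponent.supp, N.hopDist p.1 p.2

/-- The maximum number of non-root processes in a connected component. -/
noncomputable def nMaxCC : ℕ :=
  ⨆ c : N.graph.ConnectedComponent, (c.supp \ {N.root}).ncard

/-- The non-root processes. -/
abbrev NonRoot : Type _ := {u : V // u ≠ N.root}

/-- A configuration gives the state of every non-root process; the root only has constants. -/
abbrev Config : Type _ := N.NonRoot → State Lbl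

section Algorithm

variable {N}
variable (γ : N.Config)

open Classical in
/-- The status of a process; the constant `C` for the root. -/
noncomputable def st (u : V) : Status :=
  if h : u = N.root then Status.C else (γ ⟨u, h⟩).st

open Classical in
/-- The parent pointer of a process; the constant `⊥` (here `none`) for the root. -/
noncomputable def par (u : V) : Option Lbl :=
  if h : u = N.root then none else some (γ ⟨u, h⟩).par

open Classical in
/-- The distance value of a process; the constant `0` for the root. -/
noncomputable def dst (u : V) : ℝ≥0 :=
  if h : u = N.root then 0 else (γ ⟨u, h⟩).d

/-- `v` is a neighbor of `u` and the parent pointer of `u` designates `v`. -/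
def ParentIs (u v : V) : Prop :=
  ∃ h : N.graph.Adj u v, par γ u = some (N.label u ⟨v, h⟩)

/-- The macro `children(u)`. -/
def children (u : V) : Set V :=
  {v | N.graph.Adj u v ∧ st γ u ≠ Status.I ∧ st γ v ≠ Status.I ∧ ParentIs γ v u ∧
    dst γ u + N.weight s(v, u) ≤ dst γ v ∧ (st γ v = st γ u ∨ st γ u = Status.EB)}

/-- The predicate `abRoot(u)`. -/
def AbRoot (u : V) : Prop :=
  st γ u ≠ Status.I ∧
    ((¬ ∃ v, ParentIs γ u v) ∨
      ∃ v, ParentIs γ u v ∧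
        (st γ v = Status.I ∨
          dst γ u < dst γ v + N.weight s(u, v) ∨
          (st γ u ≠ st γ v ∧ st γ v ≠ Status.EB)))

/-- The predicate `P_reset(u)`. -/
def PReset (u : V) : Prop :=
  st γ u = Status.EF ∧ AbRoot γ u

/-- The predicate `P_correction(u)`. -/
def PCorrection (u : V) : Prop :=
  ∃ v, N.graph.Adj u v ∧ st γ v = Status.C ∧ dst γ v + N.weight s(u, v) < dst γ u

/-- The macro `computePath(u)`, with new state `s`: the new parent is a neighbor `v` of status `C`
minimizing `d_v + ω(u,v)`. Ties may be broken arbitrarily. -/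
def ComputePath (u : V) (s : State Lbl) : Prop :=
  ∃ (v : V) (h : N.graph.Adj u v),
    st γ v = Status.C ∧
    (∀ w, N.graph.Adj u w → st γ w = Status.C →
      dst γ v + N.weight s(u, v) ≤ dst γ w + N.weight s(u, w)) ∧
    s = ⟨Status.C, N.label u ⟨v, h⟩, dst γ v + N.weight s(u, v)⟩

end Algorithm

end Network

/-- The names of the rules of the algorithm. -/
inductive Rule
  | RC
  | REB
  | REF
  | RI
  | RR

namespace Network

section Semantics

variable {V Lbl : Type*} {N : Network V Lbl}

/-- The guards of the rules. -/
def Guard (γ : N.Config) (u : N.NonRoot) : Rule → Prop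
  | Rule.RC => st γ u = Status.C ∧ PCorrection γ u
  | Rule.REB => st γ u = Status.C ∧ ¬ PCorrection γ u ∧
      (AbRoot γ u ∨ ∃ v, ParentIs γ u v ∧ st γ v = Status.EB)
  | Rule.REF => st γ u = Status.EB ∧ ∀ v ∈ children γ (u : V), st γ v = Status.EF
  | Rule.RI => PReset γ u ∧ ∀ v, N.graph.Adj u v → st γ v ≠ Status.C
  | Rule.RR => (PReset γ u ∨ st γ u = Status.I) ∧ ∃ v, N.graph.Adj u v ∧ st γ v = Status.C

/-- The actions of the rules: `Action γ u R s` says that `s` is a possible new state of `u` when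
`u` executes the action of rule `R` in configuration `γ`. -/
def Action (γ : N.Config) (u : N.NonRoot) : Rule → State Lbl → Prop
  | Rule.RC, s => ComputePath γ u s
  | Rule.REB, s => s = { γ u with st := Status.EB }
  | Rule.REF, s => s = { γ u with st := Status.EF }
  | Rule.RI, s => s = { γ u with st := Status.I }
  | Rule.RR, s => ComputePath γ u s

/-- A process is enabled if the guard of one of its rules holds. -/
def Enabled (γ : N.Config) (u : N.NonRoot) : Prop :=
  ∃ R, Guard γ u R

/-- A terminal configuration: no process is enabled. -/
def Terminal (γ : N.Config) : Prop :=
  ∀ u, ¬ Enabled γ u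

/-- The step from `γ` to `γ'` in which exactly the processes of the nonempty set `X` of enabled
processes atomically execute one of their enabled rules. -/
def Step (γ : N.Config) (X : Set N.NonRoot) (γ' : N.Config) : Prop :=
  X.Nonempty ∧
    (∀ u ∈ X, ∃ R, Guard γ u R ∧ Action γ u R (γ' u)) ∧
    ∀ u, u ∉ X → γ' u = γ u

end Semantics

/-- An execution (under the distributed unfair daemon): a maximal sequence of configurations
`conf 0, conf 1, …` linked by steps, with an arbitrary initial configuration. Here `len` is the
number of steps (possibly infinite) and `sel i` is the set of processes executing a rule in the
step from `conf i` to `conf (i + 1)`. The values of `conf` and `sel` beyond `len` are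
meaningless. -/
structure Execution {V Lbl : Type*} (N : Network V Lbl) where
  len : ℕ∞
  conf : ℕ → N.Config
  sel : ℕ → Set N.NonRoot
  step : ∀ i : ℕ, (i : ℕ∞) < len → Step (conf i) (sel i) (conf (i + 1))
  maximal : ∀ i : ℕ, (i : ℕ∞) = len → Terminal (conf i)

namespace Execution

variable {V Lbl : Type*} {N : Network V Lbl} (e : Execution N)

/-- Process `u` is neutralized during the step from `conf k` to `conf (k + 1)`. -/
def Neutralized (u : N.NonRoot) (k : ℕ) : Prop :=
  Enabled (e.conf k) u ∧ ¬ Enabled (e.conf (k + 1)) u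

/-- Between `conf i` and `conf j`, every process enabled in `conf i` executes a rule or is
neutralized. -/
def Covers (i j : ℕ) : Prop :=
  ∀ u, Enabled (e.conf i) u → ∃ k, i ≤ k ∧ k < j ∧ (u ∈ e.sel k ∨ e.Neutralized u k)

/-- `conf i, …, conf j` is the first round of the suffix of the execution that starts at `conf i`,
i.e. its minimal prefix in which every process enabled in `conf i` executes a rule or is
neutralized. -/
def IsRound (i j : ℕ) : Prop :=
  i ≤ j ∧ (j : ℕ∞) ≤ e.len ∧ e.Covers i j ∧ ∀ j', i ≤ j' → e.Covers i j' → j ≤ j'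

/-- `RoundsEndAt k j`: the first `k` rounds of the execution are complete and the `k`-th of them
ends at `conf j`. -/
inductive RoundsEndAt : ℕ → ℕ → Prop
  | zero : RoundsEndAt 0 0
  | succ {k i j : ℕ} : RoundsEndAt k i → e.IsRound i j → RoundsEndAt (k + 1) j

/-- The execution lasts at most `B` rounds: it is finite, and its terminal configuration is the
end of its `k`-th round for some `k ≤ B`. -/
def LastsAtMostRounds (B : ℕ) : Prop :=
  ∃ L : ℕ, e.len = L ∧ ∃ k ≤ B, e.RoundsEndAt k L

end Execution

end Network

end RSP

namespace RSP

namespace Network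

variable {V Lbl : Type*} {N : Network V Lbl} {γ γ' : N.Config} {X : Set N.NonRoot}

/-! ### Local variables -/

/-! A link `u ∈ children γ v` strictly increases `dst`, so these links form a forest in which every
process of status other than `I` is a child or an abnormal root. A branch below a non-root abnormal
root consists of distinct non-root processes of one component, whence depths are at most `nMaxCC`
(`Depth.le_nMaxCC`). The decisive fact is that no step creates an abnormal root of status `C` or
`EB` (`Step.abRoot_of_abRoot`).

Finiteness needs its own argument, since under an unfair daemon a round might never end. In an
infinite execution the set of alive abnormal roots would stabilize; each process would then change
status finitely often, so that only `R_C` would run in the end (`eventually_st_C`). The sum of the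
distances would strictly decrease forever inside a well-ordered set of reals (`not_forall_step`).

Rounds are counted in four phases, each gaining one level per round. `C` leaves the abnormal trees
from the top down (`NoShallowC`), `EB` disappears from the bottom up (`EBBound`), `EF` from the top
down (`EFBound`), and exact distances then spread along shortest paths (`ExactUpTo`). The first
three phases cost `nMaxCC` rounds each, the last `hopDiam`. The common tool is to look backward: a
defect left at the end of a round was there throughout it, at a process that was always enabled and
yet never moved (`IsRound.not_of_backward`). -/

@[simp] theorem st_root : st γ N.root = Status.C := by simp [st]

@[simp] theorem dst_root : dst γ N.root = 0 := by simp [dst]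

@[simp] theorem st_coe (u : N.NonRoot) : st γ (u : V) = (γ u).st := by simp [st, u.2]

@[simp] theorem dst_coe (u : N.NonRoot) : dst γ (u : V) = (γ u).d := by simp [dst, u.2]

@[simp] theorem par_coe (u : N.NonRoot) : par γ (u : V) = some (γ u).par := by simp [par, u.2]

theorem ParentIs.ne_root {u v : V} (h : ParentIs γ u v) : u ≠ N.root := by
  rintro rfl
  obtain ⟨_, h⟩ := h
  simp [par] at h

theorem ParentIs.unique {u v w : V} (hv : ParentIs γ u v) (hw : ParentIs γ u w) : v = w := by
  obtain ⟨h₁, e₁⟩ := hv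
  obtain ⟨h₂, e₂⟩ := hw
  have := (N.label u).injective (Option.some.inj (e₁.symm.trans e₂))
  exact congrArg Subtype.val this

theorem ParentIs.congr {u : V} (h : par γ' u = par γ u) {v : V} :
    ParentIs γ' u v ↔ ParentIs γ u v := by
  simp only [ParentIs, h]

/-! ### Trees of parent pointers -/

theorem weight_pos_of_adj {u v : V} (h : N.graph.Adj u v) : 0 < N.weight s(u, v) :=
  N.weight_pos _ h

theorem dst_lt_of_mem_children {u v : V} (h : u ∈ children γ v) : dst γ v < dst γ u :=
  (lt_add_of_pos_right _ (weight_pos_of_adj h.1.symm)).trans_le h.2.2.2.2.1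

theorem ne_root_of_mem_children {u v : V} (h : u ∈ children γ v) : u ≠ N.root :=
  h.2.2.2.1.ne_root

theorem not_abRoot_of_mem_children {u v : V} (h : u ∈ children γ v) : ¬ AbRoot γ u := by
  obtain ⟨_, hv, _, hp, hd, hs⟩ := h
  rintro ⟨_, hn | ⟨w, hw, hn⟩⟩
  · exact hn ⟨v, hp⟩
  · obtain rfl := hp.unique hw
    rcases hn with hn | hn | hn
    · exact hv hn
    · exact absurd hd (not_le.2 hn)
    · exact hs.elim hn.1 hn.2

/-- Together with `not_abRoot_of_mem_children` this is a dichotomy. The root, having no parent,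
formally satisfies `AbRoot`; abnormal trees must therefore exclude it explicitly. -/
theorem abRoot_or_mem_children {u : V} (h : st γ u ≠ Status.I) :
    AbRoot γ u ∨ ∃ v, u ∈ children γ v := by
  by_cases ha : AbRoot γ u
  · exact Or.inl ha
  · right
    simp only [AbRoot, not_and, not_or, not_not, not_exists, not_lt] at ha
    obtain ⟨hn, ha⟩ := ha h
    obtain ⟨v, hv⟩ := not_forall_not.1 hn
    obtain ⟨h₁, h₂, h₃⟩ := ha v hv
    refine ⟨v, hv.1.symm, h₁, h, hv, h₂, ?_⟩
    by_cases hs : st γ u = st γ v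
    · exact Or.inl hs
    · exact Or.inr (h₃ hs)

/-- `u` is the `k`-th process on a branch of a tree rooted at an abnormal root. -/
inductive Depth (γ : N.Config) : ℕ → V → Prop
  | root {u : V} : u ≠ N.root → AbRoot γ u → Depth γ 1 u
  | child {k : ℕ} {u v : V} : u ∈ children γ v → Depth γ k v → Depth γ (k + 1) u

theorem Depth.pos {k : ℕ} {u : V} (h : Depth γ k u) : 1 ≤ k := by
  cases h <;> omega

theorem Depth.ne_root {k : ℕ} {u : V} (h : Depth γ k u) : u ≠ N.root := by
  cases h with
  | root h _ => exact h
  | child h _ => exact ne_root_of_mem_children h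

theorem Depth.st_ne_I {k : ℕ} {u : V} (h : Depth γ k u) : st γ u ≠ Status.I := by
  cases h with
  | root _ h => exact h.1
  | child h _ => exact h.2.2.1

/-- Distances strictly increase down a branch, so its processes are distinct. -/
theorem Depth.exists_finset {k : ℕ} {u : V} (h : Depth γ k u) :
    ∃ s : Finset V, s.card = k ∧ ∀ v ∈ s, v ≠ N.root ∧ N.graph.Reachable v u ∧
      dst γ v ≤ dst γ u := by
  classical
  induction h with
  | @root u h _ => exact ⟨{u}, by simp, by simp [h]⟩
  | @child k u v hc _ ih =>
    obtain ⟨s, hs, hp⟩ := ih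
    have hlt := dst_lt_of_mem_children hc
    refine ⟨insert u s, ?_, ?_⟩
    · rw [Finset.card_insert_of_notMem, hs]
      intro hu
      exact absurd (hp u hu).2.2 (not_le.2 hlt)
    · intro w hw
      rcases Finset.mem_insert.1 hw with rfl | hw
      · exact ⟨ne_root_of_mem_children hc, .refl _, le_rfl⟩
      · obtain ⟨h₁, h₂, h₃⟩ := hp w hw
        exact ⟨h₁, h₂.trans hc.1.reachable, h₃.trans hlt.le⟩

theorem Depth.le_nMaxCC [Finite V] {k : ℕ} {u : V} (h : Depth γ k u) : k ≤ N.nMaxCC := by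
  obtain ⟨s, rfl, hs⟩ := h.exists_finset
  have hb : BddAbove (Set.range fun c : N.graph.ConnectedComponent =>
      (c.supp \ {N.root}).ncard) := by
    refine ⟨Nat.card V, ?_⟩
    rintro _ ⟨c, rfl⟩
    exact Set.ncard_le_card _
  refine le_trans ?_ (le_ciSup hb (N.graph.connectedComponentMk u))
  rw [← Set.ncard_coe_finset]
  refine Set.ncard_le_ncard ?_ (Set.toFinite _)
  intro v hv
  obtain ⟨h₁, h₂, _⟩ := hs v hv
  exact ⟨SimpleGraph.ConnectedComponent.eq.2 h₂, h₁⟩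

/-- Induction along the parent pointers. -/
theorem dst_induction [Finite V] (γ : N.Config) {P : V → Prop}
    (h : ∀ u, (∀ v, dst γ v < dst γ u → P v) → P u) (u : V) : P u := by
  have : IsWellFounded V (fun a b => dst γ a < dst γ b) := by
    have : Std.Irrefl (fun a b : V => dst γ a < dst γ b) := ⟨fun _ => lt_irrefl _⟩
    have : IsTrans V (fun a b : V => dst γ a < dst γ b) := ⟨fun _ _ _ => lt_trans⟩
    exact ⟨Finite.wellFounded_of_trans_of_irrefl _⟩
  exact IsWellFounded.induction (fun a b => dst γ a < dst γ b) u h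

/-- The parent of a child of status `EB` or `EF` has one of these statuses too, so the climb cannot
end at the root, whose status is `C`. -/
theorem exists_depth [Finite V] {u : V} (hI : st γ u ≠ Status.I) (hC : st γ u ≠ Status.C) :
    ∃ k, Depth γ k u := by
  induction u using dst_induction γ with
  | h u ih =>
    rcases abRoot_or_mem_children hI with ha | ⟨v, hv⟩
    · refine ⟨1, .root ?_ ha⟩
      rintro rfl
      exact hC st_root
    · have hvC : st γ v ≠ Status.C := by
        rcases hv.2.2.2.2.2 with h | h
        · exact h ▸ hC
        · simp [h]
      obtain ⟨k, hk⟩ := ih v (dst_lt_of_mem_children hv) hv.2.1 hvC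
      exact ⟨k + 1, .child hv hk⟩

/-! ### Effect of a step on one process -/

/-- The change of a process that executes `computePath`. -/
structure Computes (γ γ' : N.Config) (u v : V) : Prop where
  guard : (st γ u = Status.C ∧ PCorrection γ u) ∨ PReset γ u ∨ st γ u = Status.I
  adj : N.graph.Adj u v
  st_eq : st γ v = Status.C
  min : ∀ w, N.graph.Adj u w → st γ w = Status.C →
    dst γ v + N.weight s(u, v) ≤ dst γ w + N.weight s(u, w)
  st_new : st γ' u = Status.C
  parentIs : ParentIs γ' u v
  dst_new : dst γ' u = dst γ v + N.weight s(u, v)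

/-- The change of a process that executes a rule which only modifies its status. -/
inductive Switches (γ γ' : N.Config) (u : V) : Prop
  | toEB : st γ u = Status.C → ¬ PCorrection γ u →
      (AbRoot γ u ∨ ∃ v, ParentIs γ u v ∧ st γ v = Status.EB) → st γ' u = Status.EB →
      Switches γ γ' u
  | toEF : st γ u = Status.EB → (∀ v ∈ children γ u, st γ v = Status.EF) →
      st γ' u = Status.EF → Switches γ γ' u
  | toI : PReset γ u → (∀ v, N.graph.Adj u v → st γ v ≠ Status.C) → st γ' u = Status.I →
      Switches γ γ' u

theorem Step.eq_of_notMem (h : Step γ X γ') {u : N.NonRoot} (hu : u ∉ X) :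
    st γ' u = st γ u ∧ par γ' u = par γ u ∧ dst γ' u = dst γ u := by
  simp [h.2.2 u hu]

theorem Step.computes_or_switches (h : Step γ X γ') {u : N.NonRoot} (hu : u ∈ X) :
    (∃ v, Computes γ γ' u v) ∨
      (Switches γ γ' u ∧ par γ' u = par γ u ∧ dst γ' u = dst γ u) := by
  obtain ⟨R, hG, hA⟩ := h.2.1 u hu
  have key : ∀ hg : (st γ u = Status.C ∧ PCorrection γ u) ∨ PReset γ u ∨ st γ u = Status.I,
      ComputePath γ u (γ' u) → ∃ v, Computes γ γ' u v := by
    rintro hg ⟨v, ha, hv, hm, hs⟩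
    refine ⟨v, hg, ha, hv, hm, ?_, ⟨ha, ?_⟩, ?_⟩ <;> simp [hs]
  cases R with
  | RC => exact Or.inl (key (Or.inl hG) hA)
  | RR => exact Or.inl (key (Or.inr hG.1) hA)
  | REB =>
    have hA : γ' u = { γ u with st := Status.EB } := hA
    exact Or.inr ⟨.toEB hG.1 hG.2.1 hG.2.2 (by simp [hA]), by simp [hA], by simp [hA]⟩
  | REF =>
    have hA : γ' u = { γ u with st := Status.EF } := hA
    exact Or.inr ⟨.toEF hG.1 hG.2 (by simp [hA]), by simp [hA], by simp [hA]⟩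
  | RI =>
    have hA : γ' u = { γ u with st := Status.I } := hA
    exact Or.inr ⟨.toI hG.1 hG.2 (by simp [hA]), by simp [hA], by simp [hA]⟩

/-- In a step, a process computes a path, or it keeps its parent and distance and possibly
switches its status. -/
theorem Step.effect (h : Step γ X γ') (u : V) :
    (∃ v, Computes γ γ' u v) ∨
      ((st γ' u = st γ u ∨ Switches γ γ' u) ∧ par γ' u = par γ u ∧ dst γ' u = dst γ u) := by
  by_cases hr : u = N.root
  · subst hr
    exact Or.inr ⟨Or.inl (by simp), by simp [par], by simp⟩
  · by_cases hu : (⟨u, hr⟩ : N.NonRoot) ∈ X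
    · rcases h.computes_or_switches hu with hc | ⟨hs, hp⟩
      · exact Or.inl hc
      · exact Or.inr ⟨Or.inr hs, hp⟩
    · obtain ⟨h₁, h₂⟩ := h.eq_of_notMem hu
      exact Or.inr ⟨Or.inl h₁, h₂⟩

theorem Computes.st_old {u v : V} (h : Computes γ γ' u v) : st γ u ≠ Status.EB := by
  rcases h.guard with h | h | h
  · simp [h.1]
  · simp [h.1]
  · simp [h]

theorem Computes.dst_lt {u v : V} (h : Computes γ γ' u v) (hC : st γ u = Status.C) :
    dst γ' u < dst γ u := by
  rcases h.guard with ⟨_, w, hw⟩ | hg | hg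
  · rw [h.dst_new]
    exact (h.min w hw.1 hw.2.1).trans_lt hw.2.2
  · simp [hg.1] at hC
  · simp [hg] at hC

theorem Step.of_st_C (h : Step γ X γ') {u : V} (hu : st γ u = Status.C) :
    (st γ' u = Status.C ∨ st γ' u = Status.EB) ∧ dst γ' u ≤ dst γ u := by
  rcases h.effect u with ⟨v, hc⟩ | ⟨hs | hs, _, hd⟩
  · exact ⟨Or.inl hc.st_new, (hc.dst_lt hu).le⟩
  · exact ⟨Or.inl (hs.trans hu), hd.le⟩
  · refine ⟨?_, hd.le⟩
    cases hs with
    | toEB _ _ _ h => exact Or.inr h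
    | toEF h => simp [hu] at h
    | toI h => simp [h.1] at hu

theorem Step.of_st_EB (h : Step γ X γ') {u : V} (hu : st γ u = Status.EB) :
    (st γ' u = Status.EB ∨ (st γ' u = Status.EF ∧ ∀ v ∈ children γ u, st γ v = Status.EF)) ∧
      par γ' u = par γ u ∧ dst γ' u = dst γ u := by
  rcases h.effect u with ⟨v, hc⟩ | ⟨hs | hs, hp⟩
  · exact absurd hu hc.st_old
  · exact ⟨Or.inl (hs.trans hu), hp⟩
  · refine ⟨?_, hp⟩
    cases hs with
    | toEB h => simp [hu] at h
    | toEF _ h h' => exact Or.inr ⟨h', h⟩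
    | toI h => simp [h.1] at hu

theorem Step.of_st_EF (h : Step γ X γ') {u : V} (hu : st γ u = Status.EF)
    (ha : ¬ AbRoot γ u) :
    st γ' u = Status.EF ∧ par γ' u = par γ u ∧ dst γ' u = dst γ u := by
  rcases h.effect u with ⟨v, hc⟩ | ⟨hs | hs, hp⟩
  · rcases hc.guard with hg | hg | hg
    · simp [hu] at hg
    · exact absurd hg.2 ha
    · simp [hu] at hg
  · exact ⟨hs.trans hu, hp⟩
  · cases hs with
    | toEB h => simp [hu] at h
    | toEF h => simp [hu] at h
    | toI h => exact absurd h.2 ha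

/-- The chosen parent had status `C`, so even if it moves simultaneously it can only lower its
distance or turn to `EB`; neither breaks the new link. -/
theorem Step.mem_children_of_computes (h : Step γ X γ') {u v : V} (hc : Computes γ γ' u v) :
    u ∈ children γ' v := by
  obtain ⟨hv, hd⟩ := h.of_st_C hc.st_eq
  refine ⟨hc.adj.symm, ?_, ?_, hc.parentIs, ?_, ?_⟩
  · rcases hv with hv | hv <;> simp [hv]
  · simp [hc.st_new]
  · rw [hc.dst_new]
    gcongr
  · rw [hc.st_new]
    rcases hv with hv | hv <;> simp [hv]

/-- A child of status `C` or `EB` that keeps its parent pointer remains a child. -/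
theorem Step.mem_children_of_alive (h : Step γ X γ') {u v : V} (hu : u ∈ children γ v)
    (hF : st γ u ≠ Status.EF) (hp : par γ' u = par γ u) (hd : dst γ' u = dst γ u)
    (hs : st γ' u = st γ u ∨ st γ' u = Status.EB ∧ st γ v = Status.EB) :
    u ∈ children γ' v := by
  obtain ⟨ha, hvI, huI, hpar, hw, hst⟩ := id hu
  have hI' : st γ' u ≠ Status.I := by
    rcases hs with hs | hs
    · rwa [hs]
    · simp [hs.1]
  have hpar' : ParentIs γ' u v := (ParentIs.congr hp).2 hpar
  by_cases hv : st γ v = Status.EB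
  · obtain ⟨h₁, _, h₃⟩ := h.of_st_EB hv
    -- The parent cannot move on to `EF`, because its child `u` is not yet `EF`.
    have h₁ : st γ' v = Status.EB := h₁.resolve_right fun hh => hF (hh.2 u hu)
    exact ⟨ha, by simp [h₁], hI', hpar', by rwa [h₃, hd], Or.inr h₁⟩
  · have hst := hst.resolve_right hv
    have hs := hs.resolve_right fun hh => hv hh.2
    have hC : st γ v = Status.C := by
      rw [hst] at hF
      cases hx : st γ v <;> simp_all
    obtain ⟨h₁, h₂⟩ := h.of_st_C hC
    refine ⟨ha, ?_, hI', hpar', ?_, ?_⟩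
    · rcases h₁ with h₁ | h₁ <;> simp [h₁]
    · rw [hd]
      exact le_trans (by gcongr) hw
    · rw [hs, hst, hC]
      rcases h₁ with h₁ | h₁ <;> simp [h₁]

/-- A process of status `C` or `EB` either has just computed its path, or had status `C` or `EB`,
the same parent and the same distance before. -/
theorem Step.alive_effect (h : Step γ X γ') {u : V} (hI : st γ' u ≠ Status.I)
    (hF : st γ' u ≠ Status.EF) :
    (∃ v, Computes γ γ' u v) ∨
      (par γ' u = par γ u ∧ dst γ' u = dst γ u ∧ (st γ' u = st γ u ∨
        st γ u = Status.C ∧ st γ' u = Status.EB ∧ ¬ PCorrection γ u ∧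
          (AbRoot γ u ∨ ∃ v, ParentIs γ u v ∧ st γ v = Status.EB))) := by
  rcases h.effect u with hc | ⟨hs | hs, hp, hd⟩
  · exact Or.inl hc
  · exact Or.inr ⟨hp, hd, Or.inl hs⟩
  · refine Or.inr ⟨hp, hd, Or.inr ?_⟩
    cases hs with
    | toEB h₁ h₂ h₃ h₄ => exact ⟨h₁, h₄, h₂, h₃⟩
    | toEF _ _ h => exact absurd h hF
    | toI _ _ h => exact absurd h hI

/-- No abnormal root of status `C` or `EB` is created. -/
theorem Step.abRoot_of_abRoot (h : Step γ X γ') {u : V} (ha : AbRoot γ' u)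
    (hF : st γ' u ≠ Status.EF) :
    AbRoot γ u ∧ st γ u ≠ Status.EF ∧ par γ' u = par γ u ∧ dst γ' u = dst γ u := by
  rcases h.alive_effect ha.1 hF with ⟨v, hc⟩ | ⟨hp, hd, hs⟩
  · exact absurd ha (not_abRoot_of_mem_children (h.mem_children_of_computes hc))
  · have hF' : st γ u ≠ Status.EF := by
      rcases hs with hs | hs
      · rwa [← hs]
      · simp [hs.1]
    have hI' : st γ u ≠ Status.I := by
      rcases hs with hs | hs
      · rw [← hs]
        exact ha.1
      · simp [hs.1]
    refine ⟨?_, hF', hp, hd⟩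
    by_contra hn
    obtain ⟨v, hv⟩ := (abRoot_or_mem_children hI').resolve_left hn
    refine not_abRoot_of_mem_children (h.mem_children_of_alive hv hF' hp hd ?_) ha
    rcases hs with hs | ⟨_, hs, _, hs' | ⟨w, hw, hs'⟩⟩
    · exact Or.inl hs
    · exact absurd hs' hn
    · obtain rfl := hw.unique hv.2.2.2.1
      exact Or.inr ⟨hs, hs'⟩

/-! ### Termination -/

/-- The abnormal roots of status `C` or `EB`. -/
def aliveAbRoots (γ : N.Config) : Set V :=
  {u | AbRoot γ u ∧ st γ u ≠ Status.EF}

theorem Step.aliveAbRoots_subset (h : Step γ X γ') : aliveAbRoots γ' ⊆ aliveAbRoots γ :=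
  fun _ hu => let h' := h.abRoot_of_abRoot hu.1 hu.2; ⟨h'.1, h'.2.1⟩

/-- `u` belongs to a tree whose root is an abnormal root of status `EB`, on a branch all of whose
processes up to `u` have status `EB` or `EF`. -/
inductive Doomed (γ : N.Config) : V → Prop
  | root {u : V} : AbRoot γ u → st γ u = Status.EB → Doomed γ u
  | child {u v : V} : u ∈ children γ v → Doomed γ v →
      (st γ u = Status.EB ∨ st γ u = Status.EF) → Doomed γ u

theorem Doomed.st_eq {u : V} (h : Doomed γ u) :
    st γ u = Status.EB ∨ st γ u = Status.EF ∧ ¬ AbRoot γ u := by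
  cases h with
  | root _ h => exact Or.inl h
  | child h _ h' => exact h'.imp_right fun h' => ⟨h', not_abRoot_of_mem_children h⟩

theorem doomed_of_st_EB [Finite V] {u : V} (hu : st γ u = Status.EB) : Doomed γ u := by
  induction u using dst_induction γ with
  | h u ih =>
    rcases abRoot_or_mem_children (γ := γ) (u := u) (by simp [hu]) with ha | ⟨v, hv⟩
    · exact .root ha hu
    · refine .child hv (ih v (dst_lt_of_mem_children hv) ?_) (Or.inl hu)
      rcases hv.2.2.2.2.2 with h | h
      · rw [← h, hu]
      · exact h

/-- The abnormal root at the top must stay alive, so it stays `EB`. Below it, a process turns to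
`EF` only when all its children already are `EF`, so no link of the branch breaks. -/
theorem Doomed.of_step {u : V} (hu : Doomed γ u) (h : Step γ X γ')
    (hA : aliveAbRoots γ ⊆ aliveAbRoots γ') : Doomed γ' u := by
  induction hu with
  | root ha hs =>
    obtain ⟨ha', hF⟩ := hA ⟨ha, by simp [hs]⟩
    exact .root ha' ((h.of_st_EB hs).1.resolve_right fun h' => hF h'.1)
  | @child u v hc hv hs ih =>
    have hu' : (st γ' u = Status.EB ∨ st γ' u = Status.EF) ∧
        par γ' u = par γ u ∧ dst γ' u = dst γ u := by
      rcases hs with hs | hs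
      · exact ⟨(h.of_st_EB hs).1.imp_right And.left, (h.of_st_EB hs).2⟩
      · obtain ⟨h₁, h₂⟩ := h.of_st_EF hs (not_abRoot_of_mem_children hc)
        exact ⟨Or.inr h₁, h₂⟩
    obtain ⟨hs', hp, hd⟩ := hu'
    obtain ⟨hadj, -, -, hpar, hw, hst⟩ := id hc
    have hv' : (st γ' v = Status.EB ∨ st γ' v = Status.EF ∧ st γ u = Status.EF) ∧
        dst γ' v = dst γ v := by
      rcases hv.st_eq with h₁ | ⟨h₁, h₂⟩
      · obtain ⟨h₃, -, h₄⟩ := h.of_st_EB h₁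
        exact ⟨h₃.imp_right fun h₃ => ⟨h₃.1, h₃.2 u hc⟩, h₄⟩
      · obtain ⟨h₃, -, h₄⟩ := h.of_st_EF h₁ h₂
        refine ⟨Or.inr ⟨h₃, ?_⟩, h₄⟩
        simpa [h₁] using hst
    obtain ⟨hv', hdv⟩ := hv'
    refine .child ⟨hadj, ?_, ?_, (ParentIs.congr hp).2 hpar, by rwa [hdv, hd], ?_⟩ ih hs'
    · rcases hv' with h₁ | h₁
      · simp [h₁]
      · simp [h₁.1]
    · rcases hs' with h₁ | h₁ <;> simp [h₁]
    · rcases hv' with h₁ | ⟨h₁, h₂⟩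
      · exact Or.inr h₁
      · exact Or.inl ((h.of_st_EF h₂ (not_abRoot_of_mem_children hc)).1.trans h₁.symm)

theorem Step.notMem_of_doomed (h : Step γ X γ') {u : N.NonRoot} (hu : Doomed γ u)
    (hF : st γ u = Status.EF) : u ∉ X := by
  intro hX
  obtain ⟨-, ha⟩ := hu.st_eq.resolve_left (by rw [hF]; simp)
  rcases h.computes_or_switches hX with ⟨v, hc⟩ | ⟨hs, -⟩
  · rcases hc.guard with hg | hg | hg
    · simp only [hF] at hg
      cases hg.1
    · exact ha hg.2
    · simp only [hF] at hg
      cases hg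
  · cases hs with
    | toEB h => simp only [hF] at h; cases h
    | toEF h => simp only [hF] at h; cases h
    | toI h => exact ha h.2

open Filter in
/-- If no alive abnormal root disappears any more, then eventually a process only executes the
rule `R_C`. -/
theorem eventually_st_C [Finite V] {conf : ℕ → N.Config} {sel : ℕ → Set N.NonRoot}
    (hstep : ∀ i, Step (conf i) (sel i) (conf (i + 1))) {T : ℕ}
    (hA : ∀ i ≥ T, aliveAbRoots (conf i) ⊆ aliveAbRoots (conf (i + 1))) (u : N.NonRoot) :
    ∀ᶠ i in atTop, u ∈ sel i → st (conf i) u = Status.C ∧ st (conf (i + 1)) u = Status.C := by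
  rw [eventually_atTop]
  -- Once `EB` after time `T`, the process is doomed forever and can only switch once more, to `EF`.
  -- If it is never `EB`, then a status `C` persists, and a process that is never `C` either can
  -- only execute `R_I`, once.
  by_cases hEB : ∃ i ≥ T, st (conf i) u = Status.EB
  · obtain ⟨i, hi, hEB⟩ := hEB
    have hD : ∀ j ≥ i, Doomed (conf j) u := by
      intro j hj
      induction j, hj using Nat.le_induction with
      | base => exact doomed_of_st_EB hEB
      | succ j hj ih => exact ih.of_step (hstep j) (hA j (hi.le.trans hj))
    by_cases hEF : ∃ j ≥ i, st (conf j) u = Status.EF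
    · obtain ⟨j, hj, hEF⟩ := hEF
      have hEF' : ∀ k ≥ j, st (conf k) u = Status.EF := by
        intro k hk
        induction k, hk using Nat.le_induction with
        | base => exact hEF
        | succ k hk ih =>
          have ha := ((hD k (hj.le.trans hk)).st_eq.resolve_left (by rw [ih]; simp)).2
          exact ((hstep k).of_st_EF ih ha).1
      exact ⟨j, fun k hk hu =>
        absurd hu ((hstep k).notMem_of_doomed (hD k (hj.le.trans hk)) (hEF' k hk))⟩
    · refine ⟨i, fun k hk hu => ?_⟩
      push Not at hEF
      have h₁ := (hD k hk).st_eq.resolve_right fun h => hEF k hk h.1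
      have h₂ := (hD (k + 1) (by omega)).st_eq.resolve_right fun h => hEF (k + 1) (by omega) h.1
      exfalso
      rcases (hstep k).computes_or_switches hu with ⟨v, hc⟩ | ⟨hs, -⟩
      · exact hc.st_old h₁
      · cases hs with
        | toEB h => rw [h₁] at h; cases h
        | toEF _ _ h => rw [h₂] at h; cases h
        | toI h => rw [h.1] at h₁; cases h₁
  · push Not at hEB
    by_cases hC : ∃ i ≥ T, st (conf i) u = Status.C
    · obtain ⟨i, hi, hC⟩ := hC
      have hC' : ∀ j ≥ i, st (conf j) u = Status.C := by
        intro j hj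
        induction j, hj using Nat.le_induction with
        | base => exact hC
        | succ j hj ih =>
          exact ((hstep j).of_st_C ih).1.resolve_right (hEB (j + 1) (by omega))
      exact ⟨i, fun k hk _ => ⟨hC' k hk, hC' (k + 1) (by omega)⟩⟩
    · push Not at hC
      have key : ∀ k ≥ T, u ∈ sel k → st (conf k) u ≠ Status.I ∧
          st (conf (k + 1)) u = Status.I := by
        intro k hk hu
        rcases (hstep k).computes_or_switches hu with ⟨v, hc⟩ | ⟨hs, -⟩
        · exact absurd hc.st_new (hC (k + 1) (by omega))
        · cases hs with
          | toEB h => exact absurd h (hC k hk)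
          | toEF h => exact absurd h (hEB k hk)
          | toI h _ h' => exact ⟨by rw [h.1]; simp, h'⟩
      by_cases hI : ∃ i ≥ T, st (conf i) u = Status.I
      · obtain ⟨i, hi, hI⟩ := hI
        have hI' : ∀ k ≥ i, st (conf k) u = Status.I := by
          intro k hk
          induction k, hk using Nat.le_induction with
          | base => exact hI
          | succ k hk ih =>
            by_cases hk' : u ∈ sel k
            · exact (key k (hi.le.trans hk) hk').2
            · exact ((hstep k).eq_of_notMem hk').1.trans ih
        exact ⟨i, fun k hk hu => absurd (hI' k hk) (key k (hi.le.trans hk) hu).1⟩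
      · push Not at hI
        exact ⟨T, fun k hk hu => absurd (key k hk hu).2 (hI (k + 1) (by omega))⟩

open Filter in
/-- Under the unfair daemon, there is no infinite sequence of steps. -/
theorem not_forall_step [Finite V] (conf : ℕ → N.Config) (sel : ℕ → Set N.NonRoot) :
    ¬ ∀ i, Step (conf i) (sel i) (conf (i + 1)) := by
  classical
  intro hstep
  have := Fintype.ofFinite V
  obtain ⟨T, hT⟩ := WellFoundedLT.antitone_chain_condition
    (f := fun i => aliveAbRoots (conf i))
    (antitone_nat_of_succ_le fun i => (hstep i).aliveAbRoots_subset)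
  have hA : ∀ i ≥ T, aliveAbRoots (conf i) ⊆ aliveAbRoots (conf (i + 1)) := fun i hi =>
    ((hT i hi).symm.trans (hT (i + 1) (by omega))).subset
  obtain ⟨T', hT'⟩ := eventually_atTop.1 (eventually_all.2 fun u => eventually_st_C hstep hA u)
  have hlt : ∀ i ≥ T', ∀ u ∈ sel i, ∃ v, Computes (conf i) (conf (i + 1)) u v := by
    intro i hi u hu
    obtain ⟨h₁, h₂⟩ := hT' i hi u hu
    refine ((hstep i).computes_or_switches hu).resolve_right fun hs => ?_
    cases hs.1 with
    | toEB _ _ _ h => rw [h₂] at h; cases h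
    | toEF _ _ h => rw [h₂] at h; cases h
    | toI _ _ h => rw [h₂] at h; cases h
  -- From `T'` on, every distance is a sum of distances at `T'` and edge weights. The monoid
  -- generated by these finitely many nonnegative reals is partially well-ordered, so it contains no
  -- strictly decreasing sequence.
  let W : Set ℝ≥0 := Set.range (dst (conf T')) ∪ Set.range N.weight
  have hW : (AddSubmonoid.closure W : Set ℝ≥0).IsPWO :=
    Set.IsPWO.addSubmonoid_closure (fun _ _ => zero_le) (Set.toFinite W).isPWO
  have hmem : ∀ i v, dst (conf (T' + i)) v ∈ AddSubmonoid.closure W := by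
    intro i
    induction i with
    | zero => exact fun v => AddSubmonoid.subset_closure (Or.inl ⟨v, rfl⟩)
    | succ i ih =>
      intro v
      by_cases hr : v = N.root
      · simp [hr]
      · by_cases hv : (⟨v, hr⟩ : N.NonRoot) ∈ sel (T' + i)
        · obtain ⟨w, hc⟩ := hlt _ (by omega) _ hv
          have := hc.dst_new
          rw [← Nat.add_assoc, this]
          exact add_mem (ih w) (AddSubmonoid.subset_closure (Or.inr ⟨_, rfl⟩))
        · have := ((hstep (T' + i)).eq_of_notMem hv).2.2
          rw [← Nat.add_assoc, this]
          exact ih v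
  have hanti : StrictAnti fun i => ∑ v : N.NonRoot, dst (conf (T' + i)) v := by
    refine strictAnti_nat_of_succ_lt fun i => ?_
    have hle : ∀ u : N.NonRoot, (u ∈ sel (T' + i) →
        dst (conf (T' + (i + 1))) u < dst (conf (T' + i)) u) ∧
        (u ∉ sel (T' + i) → dst (conf (T' + (i + 1))) u = dst (conf (T' + i)) u) := by
      intro u
      refine ⟨fun hu => ?_, fun hu => ((hstep _).eq_of_notMem hu).2.2⟩
      obtain ⟨v, hc⟩ := hlt _ (by omega) u hu
      exact hc.dst_lt (hT' _ (by omega) u hu).1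
    obtain ⟨u, hu⟩ := (hstep (T' + i)).1
    refine Finset.sum_lt_sum (fun v _ => ?_) ⟨u, Finset.mem_univ _, (hle u).1 hu⟩
    by_cases hv : v ∈ sel (T' + i)
    · exact ((hle v).1 hv).le
    · exact ((hle v).2 hv).le
  obtain ⟨i, j, hij, hle⟩ := hW fun i =>
    ⟨∑ v : N.NonRoot, dst (conf (T' + i)) v, sum_mem fun v _ => hmem i v⟩
  exact absurd hle (not_le.2 (hanti hij))

/-! ### Rounds -/

theorem Step.not_terminal (h : Step γ X γ') : ¬ Terminal γ := by
  obtain ⟨u, hu⟩ := h.1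
  obtain ⟨R, hR, _⟩ := h.2.1 u hu
  exact fun ht => ht u ⟨R, hR⟩

namespace Execution

variable {e : Execution N}

theorem invariant {P : N.Config → Prop} (hP : ∀ γ X γ', Step γ X γ' → P γ → P γ') {i k : ℕ}
    (hi : P (e.conf i)) (hik : i ≤ k) (hk : (k : ℕ∞) ≤ e.len) : P (e.conf k) := by
  induction k, hik using Nat.le_induction with
  | base => exact hi
  | succ k _ ih =>
    have hlt : (k : ℕ∞) < e.len := lt_of_lt_of_le (by exact_mod_cast k.lt_succ_self) hk
    exact hP _ _ _ (e.step k hlt) (ih hlt.le)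

theorem IsRound.lt_len {i j k : ℕ} (h : e.IsRound i j) (hk : k < j) : (k : ℕ∞) < e.len :=
  lt_of_lt_of_le (by exact_mod_cast hk) h.2.1

theorem IsRound.le_len {i j k : ℕ} (h : e.IsRound i j) (hk : k ≤ j) : (k : ℕ∞) ≤ e.len :=
  le_trans (by exact_mod_cast hk) h.2.1

/-- A process that is enabled during a whole round executes a rule in this round. -/
theorem IsRound.exists_mem_sel {i j : ℕ} (h : e.IsRound i j) {u : N.NonRoot}
    (hen : ∀ k, i ≤ k → k ≤ j → Enabled (e.conf k) u) : ∃ k, i ≤ k ∧ k < j ∧ u ∈ e.sel k := by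
  obtain ⟨k, hik, hkj, hu | hu⟩ := h.2.2.1 u (hen i le_rfl h.1)
  · exact ⟨k, hik, hkj, hu⟩
  · exact absurd (hen (k + 1) (by omega) hkj) hu.2

/-- If a property `Q` of configurations can only hold after a step if it holds before the step
and `u` does not execute a rule, and if it entails that `u` is enabled, then `Q` does not hold at
the end of a round. -/
theorem IsRound.not_of_backward {i j : ℕ} (h : e.IsRound i j) (u : N.NonRoot)
    {P Q : N.Config → Prop} (hi : P (e.conf i)) (hP : ∀ γ X γ', Step γ X γ' → P γ → P γ')
    (hQ : ∀ γ X γ', Step γ X γ' → P γ → Q γ' → Q γ ∧ u ∉ X)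
    (hen : ∀ γ, P γ → Q γ → Enabled γ u) : ¬ Q (e.conf j) := by
  intro hj
  have hPk : ∀ k, i ≤ k → k ≤ j → P (e.conf k) := fun k hik hkj =>
    invariant hP hi hik (h.le_len hkj)
  have hQk : ∀ k, i ≤ k → k ≤ j → Q (e.conf k) := by
    intro k hik hkj
    induction hkj using Nat.decreasingInduction with
    | self => exact hj
    | of_succ k hkj ih =>
      exact (hQ _ _ _ (e.step k (h.lt_len hkj)) (hPk k hik hkj.le) (ih (by omega))).1
  obtain ⟨k, hik, hkj, hu⟩ :=
    h.exists_mem_sel fun k hik hkj => hen _ (hPk k hik hkj) (hQk k hik hkj)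
  exact (hQ _ _ _ (e.step k (h.lt_len hkj)) (hPk k hik hkj.le) (hQk (k + 1) (by omega) hkj)).2 hu

theorem RoundsEndAt.le_len {k i : ℕ} (h : e.RoundsEndAt k i) : (i : ℕ∞) ≤ e.len := by
  cases h with
  | zero => simp
  | succ _ h => exact h.2.1

theorem RoundsEndAt.phase {P : ℕ → N.Config → Prop} {a : ℕ}
    (h₀ : ∀ i, e.RoundsEndAt a i → P 0 (e.conf i))
    (hs : ∀ m i j, e.IsRound i j → P m (e.conf i) → P (m + 1) (e.conf j)) {m i : ℕ}
    (h : e.RoundsEndAt (a + m) i) : P m (e.conf i) := by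
  induction m generalizing i with
  | zero => exact h₀ i h
  | succ m ih =>
    cases h with
    | succ h hr => exact hs m _ _ hr (ih h)

theorem exists_isRound {L i : ℕ} (hL : e.len = L) (hi : i < L) : ∃ j, e.IsRound i j := by
  classical
  have hT : Terminal (e.conf L) := e.maximal L hL.symm
  -- Nothing is enabled at the end of the execution, so every process enabled at `i` has moved or
  -- been neutralized by then.
  have hcov : i ≤ L ∧ e.Covers i L := by
    refine ⟨hi.le, fun u hu => ?_⟩
    by_contra! hn
    have : ∀ k, i ≤ k → k ≤ L → Enabled (e.conf k) u := by
      intro k hik hk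
      induction k, hik using Nat.le_induction with
      | base => exact hu
      | succ k hik ih =>
        by_contra hne
        exact (hn k hik hk).2 ⟨ih (by omega), hne⟩
    exact hT u (this L hi.le le_rfl)
  have hex : ∃ j, i ≤ j ∧ e.Covers i j := ⟨L, hcov⟩
  refine ⟨Nat.find hex, (Nat.find_spec hex).1, ?_, (Nat.find_spec hex).2,
    fun j' h₁ h₂ => Nat.find_min' hex ⟨h₁, h₂⟩⟩
  rw [hL]
  exact_mod_cast Nat.find_min' hex hcov

/-- If every configuration that ends the first `B` rounds is terminal, then a finite execution
lasts at most `B` rounds. -/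
theorem lastsAtMostRounds_of_terminal {L B : ℕ} (hL : e.len = L)
    (hB : ∀ i, e.RoundsEndAt B i → Terminal (e.conf i)) : e.LastsAtMostRounds B := by
  have key : ∀ k, (∃ i, e.RoundsEndAt k i) ∨ ∃ k' ≤ k, e.RoundsEndAt k' L := by
    intro k
    induction k with
    | zero => exact Or.inl ⟨0, .zero⟩
    | succ k ih =>
      rcases ih with ⟨i, hi⟩ | ⟨k', hk', h⟩
      · have hle : i ≤ L := by
          have := hi.le_len
          rw [hL] at this
          exact_mod_cast this
        rcases hle.lt_or_eq with hlt | rfl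
        · obtain ⟨j, hj⟩ := exists_isRound hL hlt
          exact Or.inl ⟨j, .succ hi hj⟩
        · exact Or.inr ⟨k, by omega, hi⟩
      · exact Or.inr ⟨k', by omega, h⟩
  refine ⟨L, hL, ?_⟩
  rcases key B with ⟨i, hi⟩ | h
  · have hle := hi.le_len
    rcases hle.lt_or_eq with hlt | heq
    · exact absurd (hB i hi) (e.step i hlt).not_terminal
    · rw [hL] at heq
      obtain rfl : i = L := by exact_mod_cast heq
      exact ⟨B, le_rfl, hi⟩
  · exact h

theorem exists_len_eq [Finite V] (e : Execution N) : ∃ L : ℕ, e.len = L := by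
  by_contra! hn
  have htop : e.len = ⊤ := by
    by_contra h
    obtain ⟨L, hL⟩ := WithTop.ne_top_iff_exists.1 h
    exact hn L hL.symm
  exact not_forall_step e.conf e.sel fun i => e.step i (by rw [htop]; exact ENat.natCast_lt_top i)

end Execution

/-! ### First phase: no process of status `C` in an abnormal tree -/

/-- No process of status `C` is at depth at most `m` in an abnormal tree. -/
def NoShallowC (m : ℕ) (γ : N.Config) : Prop :=
  ∀ k u, k ≤ m → Depth γ k u → st γ u ≠ Status.C

/-- No process of an abnormal tree has status `C`. -/
def NoAbnormalC (γ : N.Config) : Prop :=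
  ∀ k u, Depth γ k u → st γ u ≠ Status.C

theorem Step.not_computes_of_abRoot (h : Step γ X γ') {u v : V} (ha : AbRoot γ' u) :
    ¬ Computes γ γ' u v :=
  fun hc => not_abRoot_of_mem_children (h.mem_children_of_computes hc) ha

/-- Backward in time, a shallow process was no deeper. It cannot have just joined the tree, because
`computePath` picks a parent of status `C` and the shallow parent had another status. Status `EF` is
excluded since the reset of a parent can turn an `EF` process into a new abnormal root. -/
theorem NoShallowC.depth_of_depth {m : ℕ} (hm : NoShallowC m γ) (h : Step γ X γ') {k : ℕ} {u : V}
    (hu : Depth γ' k u) (hk : k ≤ m + 1) (hF : st γ' u ≠ Status.EF) :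
    (∃ k' ≤ k, Depth γ k' u) ∧ ∀ v, ¬ Computes γ γ' u v := by
  induction hu with
  | root hr ha =>
    exact ⟨⟨1, le_rfl, .root hr (h.abRoot_of_abRoot ha hF).1⟩,
      fun v => h.not_computes_of_abRoot ha⟩
  | @child k u v hc hv ih =>
    have hFv : st γ' v ≠ Status.EF := by
      rcases hc.2.2.2.2.2 with h | h
      · rwa [← h]
      · simp [h]
    obtain ⟨⟨k', hk', hd⟩, hnc⟩ := ih (by omega) hFv
    have hvC := hm k' v (by omega) hd
    have hncu : ∀ w, ¬ Computes γ γ' u w := by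
      intro w hw
      obtain rfl := hw.parentIs.unique hc.2.2.2.1
      exact hvC hw.st_eq
    refine ⟨?_, hncu⟩
    obtain ⟨hp, -, hs⟩ := (h.alive_effect hc.2.2.1 hF).resolve_left (by simpa using hncu)
    have hI : st γ u ≠ Status.I := by
      rcases hs with hs | hs
      · rw [← hs]
        exact hc.2.2.1
      · simp [hs.1]
    rcases abRoot_or_mem_children hI with ha | ⟨w, hw⟩
    · exact ⟨1, by omega, .root (ne_root_of_mem_children hc) ha⟩
    · obtain rfl := hw.2.2.2.1.unique ((ParentIs.congr hp).1 hc.2.2.2.1)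
      exact ⟨k' + 1, by omega, .child hw hd⟩

theorem Step.st_C_of_not_computes (h : Step γ X γ') {u : V} (hu : st γ' u = Status.C)
    (hnc : ∀ v, ¬ Computes γ γ' u v) :
    st γ u = Status.C ∧ ∀ hr : u ≠ N.root, (⟨u, hr⟩ : N.NonRoot) ∉ X := by
  constructor
  · obtain ⟨-, -, hs | hs⟩ := (h.alive_effect (u := u) (by simp [hu]) (by simp [hu])).resolve_left
      (by simpa using hnc)
    · rw [← hs, hu]
    · simp [hs.2.1] at hu
  · intro hr hX
    obtain ⟨hs, -⟩ := (h.computes_or_switches hX).resolve_left (by simpa using hnc)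
    cases hs with
    | toEB _ _ _ h => simp [h] at hu
    | toEF _ _ h => simp [h] at hu
    | toI _ _ h => simp [h] at hu

theorem NoShallowC.of_step {m : ℕ} (hm : NoShallowC m γ) (h : Step γ X γ') :
    NoShallowC m γ' := by
  intro k u hk hu hC
  obtain ⟨⟨k', hk', hd⟩, hnc⟩ := hm.depth_of_depth h hu (by omega) (by simp [hC])
  exact hm k' u (by omega) hd (h.st_C_of_not_computes hC hnc).1

theorem NoAbnormalC.of_step (hm : NoAbnormalC γ) (h : Step γ X γ') : NoAbnormalC γ' := by
  intro k u hu
  exact NoShallowC.of_step (m := k) (fun k u _ => hm k u) h k u le_rfl hu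

/-- A process of status `C` at depth at most `m + 1` is an abnormal root or has a parent of status
`EB`, hence is enabled for `R_C` or `R_EB`. -/
theorem NoShallowC.of_isRound {e : Execution N} {m i j : ℕ} (hr : e.IsRound i j)
    (hm : NoShallowC m (e.conf i)) : NoShallowC (m + 1) (e.conf j) := by
  intro k u hk hu hC
  refine hr.not_of_backward ⟨u, hu.ne_root⟩ (P := NoShallowC m)
    (Q := fun γ => st γ u = Status.C ∧ ∃ k ≤ m + 1, Depth γ k u) hm
    (fun _ _ _ h hm => hm.of_step h) ?_ ?_ ⟨hC, k, hk, hu⟩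
  · rintro γ X γ' h hm ⟨hC, k, hk, hu⟩
    obtain ⟨⟨k', hk', hd⟩, hnc⟩ := hm.depth_of_depth h hu hk (by simp [hC])
    obtain ⟨h₁, h₂⟩ := h.st_C_of_not_computes hC hnc
    exact ⟨⟨h₁, k', by omega, hd⟩, h₂ _⟩
  · rintro γ hm ⟨hC, k, hk, hu⟩
    by_cases hc : PCorrection γ u
    · exact ⟨.RC, hC, hc⟩
    · refine ⟨.REB, hC, hc, ?_⟩
      cases hu with
      | root _ ha => exact Or.inl ha
      | @child k _ v hv hd =>
        refine Or.inr ⟨v, hv.2.2.2.1, hv.2.2.2.2.2.resolve_left ?_⟩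
        rw [hC]
        exact (hm k v (by omega) hd).symm

theorem NoShallowC.noAbnormalC [Finite V] (hm : NoShallowC N.nMaxCC γ) : NoAbnormalC γ :=
  fun k u hu => hm k u hu.le_nMaxCC hu

/-! ### Second phase: no process of status `EB` -/

theorem mem_children_congr {u v : V} (hu : st γ' u = st γ u) (hp : par γ' u = par γ u)
    (hd : dst γ' u = dst γ u) (hv : st γ' v = st γ v) (hdv : dst γ' v = dst γ v) :
    u ∈ children γ' v ↔ u ∈ children γ v := by
  simp only [children, Set.mem_ofPred_eq, hu, hd, hv, hdv, ParentIs.congr hp]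

theorem NoAbnormalC.not_abRoot (hm : NoAbnormalC γ) {u : V} (hu : st γ u = Status.C)
    (hr : u ≠ N.root) : ¬ AbRoot γ u :=
  fun ha => hm 1 u (.root hr ha) hu

theorem NoAbnormalC.exists_mem_children [Finite V] (hm : NoAbnormalC γ) {u : V}
    (hu : st γ u = Status.C) (hr : u ≠ N.root) : ∃ v, u ∈ children γ v ∧ st γ v = Status.C := by
  obtain ⟨v, hv⟩ := (abRoot_or_mem_children (by simp [hu])).resolve_left (hm.not_abRoot hu hr)
  refine ⟨v, hv, ?_⟩
  by_contra hC
  obtain ⟨k, hk⟩ := exists_depth hv.2.1 hC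
  exact hm (k + 1) u (.child hv hk) hu

/-- A non-root process of status `C` now has a parent of status `C`; hence `EB` is never acquired
again. -/
theorem NoAbnormalC.not_guard_REB [Finite V] (hm : NoAbnormalC γ) {u : V}
    (hu : st γ u = Status.C) (hr : u ≠ N.root) :
    ¬ (AbRoot γ u ∨ ∃ v, ParentIs γ u v ∧ st γ v = Status.EB) := by
  rintro (ha | ⟨v, hv, hs⟩)
  · exact hm.not_abRoot hu hr ha
  · obtain ⟨w, hw, hC⟩ := hm.exists_mem_children hu hr
    obtain rfl := hv.unique hw.2.2.2.1
    simp [hs] at hC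

theorem NoAbnormalC.of_st_EB [Finite V] (hm : NoAbnormalC γ) (h : Step γ X γ') {u : N.NonRoot}
    (hu : st γ' u = Status.EB) : u ∉ X := by
  intro hX
  rcases h.computes_or_switches hX with ⟨v, hc⟩ | ⟨hs, -⟩
  · have := hc.st_new
    rw [hu] at this
    cases this
  · cases hs with
    | toEB h₁ _ h₂ => exact hm.not_guard_REB h₁ u.2 h₂
    | toEF _ _ h => rw [hu] at h; cases h
    | toI _ _ h => rw [hu] at h; cases h

/-- All ancestors of an `EB` process up to its abnormal root are `EB`, and such processes did not
move. -/
theorem Depth.congr_of_EB [Finite V] (hm : NoAbnormalC γ) (h : Step γ X γ') {k : ℕ} {u : V}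
    (hu : Depth γ' k u) (hs : st γ' u = Status.EB) : Depth γ k u := by
  induction hu with
  | root hr ha => exact .root hr (h.abRoot_of_abRoot ha (by simp [hs])).1
  | @child k u v hc hv ih =>
    have hsv : st γ' v = Status.EB := by
      rcases hc.2.2.2.2.2 with h | h
      · rw [← h, hs]
      · exact h
    obtain ⟨h₁, h₂, h₃⟩ := h.eq_of_notMem
      (hm.of_st_EB h (u := ⟨u, ne_root_of_mem_children hc⟩) hs)
    obtain ⟨h₄, -, h₅⟩ := h.eq_of_notMem (hm.of_st_EB h (u := ⟨v, hv.ne_root⟩) hsv)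
    exact .child ((mem_children_congr h₁ h₂ h₃ h₄ h₅).1 hc) (ih hsv)

/-- The processes of status `EB` are at least `m` levels above the maximum possible depth. -/
def EBBound (m : ℕ) (γ : N.Config) : Prop :=
  NoAbnormalC γ ∧ ∀ k u, Depth γ k u → st γ u = Status.EB → k + m ≤ N.nMaxCC

theorem EBBound.of_step [Finite V] {m : ℕ} (hm : EBBound m γ) (h : Step γ X γ') :
    EBBound m γ' := by
  refine ⟨hm.1.of_step h, fun k u hu hs => hm.2 k u (hu.congr_of_EB hm.1 h hs) ?_⟩
  rw [← (h.eq_of_notMem (hm.1.of_st_EB h (u := ⟨u, hu.ne_root⟩) hs)).1, hs]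

theorem EBBound.of_isRound [Finite V] {e : Execution N} {m i j : ℕ} (hr : e.IsRound i j)
    (hm : EBBound m (e.conf i)) : EBBound (m + 1) (e.conf j) := by
  have hinv := Execution.invariant (P := EBBound m) (fun _ _ _ h hm => hm.of_step h) hm hr.1 hr.2.1
  refine ⟨hinv.1, fun k u hu hs => ?_⟩
  by_contra hlt
  refine hr.not_of_backward ⟨u, hu.ne_root⟩ (P := EBBound m)
    (Q := fun γ => st γ u = Status.EB ∧ Depth γ k u) hm
    (fun _ _ _ h hm => hm.of_step h) ?_ ?_ ⟨hs, hu⟩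
  · rintro γ X γ' h hm ⟨hs, hu⟩
    have hX := hm.1.of_st_EB h (u := ⟨u, hu.ne_root⟩) hs
    exact ⟨⟨by rw [← (h.eq_of_notMem hX).1, hs], hu.congr_of_EB hm.1 h hs⟩, hX⟩
  · rintro γ hm ⟨hs, hu⟩
    -- At the deepest level still allowed for `EB`, a child would be too deep to be `EB`, and it is
    -- neither `C` nor `I`; so it is `EF`.
    refine ⟨.REF, hs, fun v hv => ?_⟩
    have hd := hu.child hv
    have h₁ := hm.1 _ _ hd
    have h₂ := hd.st_ne_I
    have h₃ : st γ v ≠ Status.EB := fun h => by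
      have := hm.2 _ _ hd h
      omega
    cases hx : st γ v <;> simp_all

/-! ### Third phase: no process of status `EF` -/

/-- No process has status `EB` and no process of an abnormal tree has status `C`. -/
def NoAlive (γ : N.Config) : Prop :=
  NoAbnormalC γ ∧ ∀ u, st γ u ≠ Status.EB

theorem EBBound.noAlive [Finite V] (hm : EBBound N.nMaxCC γ) : NoAlive γ := by
  refine ⟨hm.1, fun u hu => ?_⟩
  obtain ⟨k, hk⟩ := exists_depth (γ := γ) (u := u) (by simp [hu]) (by simp [hu])
  have := hm.2 k u hk hu
  have := hk.pos
  omega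

theorem NoAlive.of_step [Finite V] (hm : NoAlive γ) (h : Step γ X γ') : NoAlive γ' := by
  refine ⟨hm.1.of_step h, fun u hu => ?_⟩
  have hr : u ≠ N.root := by
    rintro rfl
    simp at hu
  refine hm.2 u ?_
  rw [← (h.eq_of_notMem (hm.1.of_st_EB h (u := ⟨u, hr⟩) hu)).1, hu]

theorem NoAlive.of_st_EF (hm : NoAlive γ) (h : Step γ X γ') {u : N.NonRoot}
    (hu : st γ' u = Status.EF) : u ∉ X := by
  intro hX
  rcases h.computes_or_switches hX with ⟨v, hc⟩ | ⟨hs, -⟩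
  · have := hc.st_new
    rw [hu] at this
    cases this
  · cases hs with
    | toEB _ _ _ h => rw [hu] at h; cases h
    | toEF h => exact hm.2 u h
    | toI _ _ h => rw [hu] at h; cases h

theorem NoAlive.st_parent (hm : NoAlive γ) {u v : V} (hc : u ∈ children γ v) :
    st γ u = st γ v :=
  hc.2.2.2.2.2.resolve_right (hm.2 v)

/-- To become a child again, `u` would need a parent of status `EF`; but `EF` is no longer acquired,
so that parent was unchanged and the link already existed. -/
theorem NoAlive.abRoot_of_step [Finite V] (hm : NoAlive γ) (h : Step γ X γ') {u : V}
    (hu : st γ' u = Status.EF) (ha : AbRoot γ u) : AbRoot γ' u := by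
  by_contra hn
  obtain ⟨v, hv⟩ := (abRoot_or_mem_children (by simp [hu])).resolve_left hn
  have hsv : st γ' v = Status.EF := by rw [← (hm.of_step h).st_parent hv, hu]
  have hr : v ≠ N.root := by
    rintro rfl
    simp at hsv
  obtain ⟨h₁, h₂, h₃⟩ := h.eq_of_notMem
    (hm.of_st_EF h (u := ⟨u, ne_root_of_mem_children hv⟩) hu)
  obtain ⟨h₄, -, h₅⟩ := h.eq_of_notMem (hm.of_st_EF h (u := ⟨v, hr⟩) hsv)
  exact not_abRoot_of_mem_children ((mem_children_congr h₁ h₂ h₃ h₄ h₅).1 hv) ha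

theorem NoAlive.unchanged [Finite V] {e : Execution N} {i j : ℕ} (hr : e.IsRound i j)
    (hm : NoAlive (e.conf i)) {u : N.NonRoot} (hu : st (e.conf j) u = Status.EF) {k : ℕ}
    (hik : i ≤ k) (hkj : k ≤ j) :
    st (e.conf j) u = st (e.conf k) u ∧ par (e.conf j) u = par (e.conf k) u ∧
      dst (e.conf j) u = dst (e.conf k) u ∧ (k < j → u ∉ e.sel k) := by
  induction hkj using Nat.decreasingInduction with
  | self => simp
  | of_succ k hkj ih =>
    obtain ⟨h₁, h₂, h₃, -⟩ := ih (by omega)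
    have hs := e.step k (hr.lt_len hkj)
    have hk : NoAlive (e.conf k) :=
      Execution.invariant (fun _ _ _ h hm => hm.of_step h) hm hik (hr.le_len hkj.le)
    have hX := hk.of_st_EF hs (h₁.symm.trans hu)
    obtain ⟨h₄, h₅, h₆⟩ := hs.eq_of_notMem hX
    exact ⟨h₁.trans h₄, h₂.trans h₅, h₃.trans h₆, fun _ => hX⟩

theorem enabled_of_pReset {u : N.NonRoot} (h : PReset γ u) : Enabled γ u := by
  by_cases hC : ∃ v, N.graph.Adj u v ∧ st γ v = Status.C
  · exact ⟨.RR, Or.inl h, hC⟩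
  · push Not at hC
    exact ⟨.RI, h, hC⟩

/-- An abnormal root of status `EF` stays enabled until it moves, so none survives a round. One seen
at the end was thus a child at the start, at depth at least 2, and this gain passes down the
unchanged links. -/
theorem Depth.lt_of_isRound [Finite V] {e : Execution N} {i j : ℕ} (hr : e.IsRound i j)
    (hm : NoAlive (e.conf i)) {k : ℕ} {u : V} (hu : Depth (e.conf j) k u)
    (hs : st (e.conf j) u = Status.EF) : ∃ k' > k, Depth (e.conf i) k' u := by
  have hmk : ∀ k, i ≤ k → k ≤ j → NoAlive (e.conf k) := fun k hik hkj =>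
    Execution.invariant (fun _ _ _ h hm => hm.of_step h) hm hik (hr.le_len hkj)
  induction hu with
  | @root u hne ha =>
    have hun := fun k hik hkj => hm.unchanged hr (u := ⟨u, hne⟩) hs (k := k) hik hkj
    have hEF : ∀ k, i ≤ k → k ≤ j → st (e.conf k) u = Status.EF := fun k hik hkj => by
      rw [← hs]
      exact (hun k hik hkj).1.symm
    have hn : ¬ AbRoot (e.conf i) u := by
      intro hai
      have hak : ∀ k, i ≤ k → k ≤ j → AbRoot (e.conf k) u := by
        intro k hik hkj
        induction k, hik using Nat.le_induction with
        | base => exact hai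
        | succ k hik ih =>
          exact (hmk k hik (by omega)).abRoot_of_step (e.step k (hr.lt_len hkj))
            (hEF _ (by omega) hkj) (ih (by omega))
      obtain ⟨k, hik, hkj, hX⟩ := hr.exists_mem_sel (u := ⟨u, hne⟩) fun k hik hkj =>
        enabled_of_pReset ⟨hEF k hik hkj, hak k hik hkj⟩
      exact (hun k hik hkj.le).2.2.2 hkj hX
    have hsi := hEF i le_rfl hr.1
    obtain ⟨v, hv⟩ := (abRoot_or_mem_children (by simp [hsi])).resolve_left hn
    have hsv := hm.st_parent hv
    rw [hsi] at hsv
    obtain ⟨k, hk⟩ := exists_depth (γ := e.conf i) (u := v) (by simp [← hsv]) (by simp [← hsv])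
    exact ⟨k + 1, Nat.succ_lt_succ hk.pos, .child hv hk⟩
  | @child k u v hc hv ih =>
    have hsv : st (e.conf j) v = Status.EF := by
      rw [← (hmk j hr.1 le_rfl).st_parent hc, hs]
    obtain ⟨k', hk', hd⟩ := ih hsv
    obtain ⟨h₁, h₂, h₃, -⟩ :=
      hm.unchanged hr (u := ⟨u, ne_root_of_mem_children hc⟩) hs le_rfl hr.1
    obtain ⟨h₄, -, h₅, -⟩ := hm.unchanged hr (u := ⟨v, hv.ne_root⟩) hsv le_rfl hr.1
    exact ⟨k' + 1, by omega, .child ((mem_children_congr h₁ h₂ h₃ h₄ h₅).1 hc) hd⟩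

/-- The processes of status `EF` are at least `m` levels above the maximum possible depth. -/
def EFBound (m : ℕ) (γ : N.Config) : Prop :=
  NoAlive γ ∧ ∀ k u, Depth γ k u → st γ u = Status.EF → k + m ≤ N.nMaxCC

theorem EFBound.of_isRound [Finite V] {e : Execution N} {m i j : ℕ} (hr : e.IsRound i j)
    (hm : EFBound m (e.conf i)) : EFBound (m + 1) (e.conf j) := by
  have hj : NoAlive (e.conf j) :=
    Execution.invariant (fun _ _ _ h hm => hm.of_step h) hm.1 hr.1 hr.2.1
  refine ⟨hj, fun k u hu hs => ?_⟩
  obtain ⟨k', hk', hd⟩ := hu.lt_of_isRound hr hm.1 hs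
  have hsi : st (e.conf i) u = Status.EF := by
    rw [← hs]
    exact (hm.1.unchanged hr (u := ⟨u, hu.ne_root⟩) hs le_rfl hr.1).1.symm
  have := hm.2 k' u hd hsi
  omega

/-! ### Shortest paths -/

@[simp] theorem walkWeight_cons {u v w : V} (h : N.graph.Adj u v) (p : N.graph.Walk v w) :
    N.walkWeight (.cons h p) = N.weight s(u, v) + N.walkWeight p := by
  simp [walkWeight]

theorem exists_isPath_walkWeight_le {u v : V} (p : N.graph.Walk u v) :
    ∃ q : N.graph.Walk u v, q.IsPath ∧ N.walkWeight q ≤ N.walkWeight p := by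
  classical
  refine ⟨p.bypass, p.bypass_isPath, ?_⟩
  exact (p.edges_bypass_sublist_edges.map N.weight).sum_le_sum fun _ _ => zero_le

theorem IsShortestPath.le {u v : V} {p : N.graph.Walk u v} (hp : N.IsShortestPath p)
    (q : N.graph.Walk u v) : N.walkWeight p ≤ N.walkWeight q := by
  obtain ⟨q', hq', hle⟩ := exists_isPath_walkWeight_le q
  exact (hp.2 q' hq').trans hle

theorem IsShortestPath.of_cons {u v w : V} {h : N.graph.Adj u v} {p : N.graph.Walk v w}
    (hp : N.IsShortestPath (.cons h p)) : N.IsShortestPath p := by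
  refine ⟨hp.1.of_cons, fun q _ => ?_⟩
  have := hp.le (.cons h q)
  simpa using this

theorem exists_isShortestPath [Finite V] {u v : V} (h : N.graph.Reachable u v) :
    ∃ p : N.graph.Walk u v, N.IsShortestPath p ∧ p.length = N.hopDist u v := by
  classical
  have hne : {k : ℕ | ∃ p : N.graph.Walk u v, N.IsShortestPath p ∧ p.length = k}.Nonempty := by
    have := Fintype.ofFinite V
    obtain ⟨p⟩ := h
    have : Nonempty (N.graph.Path u v) := ⟨p.toPath⟩
    obtain ⟨q, hq⟩ := Finite.exists_min fun q : N.graph.Path u v => N.walkWeight q.1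
    exact ⟨_, q.1, ⟨q.2, fun q' hq' => hq ⟨q', hq'⟩⟩, rfl⟩
  exact Nat.sInf_mem hne

theorem hopDist_le_hopDiam [Finite V] {u : V} (h : N.graph.Reachable u N.root) :
    N.hopDist u N.root ≤ N.hopDiam := by
  have hu : u ∈ N.rootComponent.supp := SimpleGraph.ConnectedComponent.eq.2 h
  have hr : N.root ∈ N.rootComponent.supp := SimpleGraph.ConnectedComponent.eq.2 (.refl _)
  exact le_ciSup (f := fun p : N.rootComponent.supp × N.rootComponent.supp =>
    N.hopDist p.1 p.2) (Set.toFinite _).bddAbove (⟨u, hu⟩, ⟨N.root, hr⟩)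

/-! ### Fourth phase: computation of the distances -/

/-- All statuses are `C` or `I`, and no process of an abnormal tree has status `C`. -/
def Clean (γ : N.Config) : Prop :=
  NoAlive γ ∧ ∀ u, st γ u ≠ Status.EF

theorem EFBound.clean [Finite V] (hm : EFBound N.nMaxCC γ) : Clean γ := by
  refine ⟨hm.1, fun u hu => ?_⟩
  obtain ⟨k, hk⟩ := exists_depth (γ := γ) (u := u) (by simp [hu]) (by simp [hu])
  have := hm.2 k u hk hu
  have := hk.pos
  omega

theorem Clean.of_step [Finite V] (hm : Clean γ) (h : Step γ X γ') : Clean γ' := by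
  refine ⟨hm.1.of_step h, fun u hu => ?_⟩
  have hr : u ≠ N.root := by
    rintro rfl
    simp at hu
  refine hm.2 u ?_
  rw [← (h.eq_of_notMem (hm.1.of_st_EF h (u := ⟨u, hr⟩) hu)).1, hu]

/-- Parents of status `C` lead up to the root, so distances are never underestimates; only
overestimates remain to be corrected. -/
theorem Clean.exists_walk [Finite V] (hm : Clean γ) {u : V} (hu : st γ u = Status.C) :
    ∃ p : N.graph.Walk u N.root, N.walkWeight p ≤ dst γ u := by
  induction u using dst_induction γ with
  | h u ih =>
    by_cases hr : u = N.root
    · subst hr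
      exact ⟨.nil, by simp [walkWeight]⟩
    · obtain ⟨v, hv, hC⟩ := hm.1.1.exists_mem_children hu hr
      obtain ⟨p, hp⟩ := ih v (dst_lt_of_mem_children hv) hC
      refine ⟨.cons hv.1.symm p, ?_⟩
      rw [walkWeight_cons, add_comm]
      exact le_trans (by gcongr) hv.2.2.2.2.1

/-- The process `u` has status `C` and its distance is the weight of the walk `p`. -/
def Exact (γ : N.Config) {u : V} (p : N.graph.Walk u N.root) : Prop :=
  st γ u = Status.C ∧ dst γ u = N.walkWeight p

theorem Clean.walkWeight_le [Finite V] (hm : Clean γ) {u v : V} {p : N.graph.Walk u N.root}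
    (hp : N.IsShortestPath p) (h : N.graph.Adj u v) (hv : st γ v = Status.C) :
    N.walkWeight p ≤ dst γ v + N.weight s(u, v) := by
  obtain ⟨q, hq⟩ := hm.exists_walk hv
  have := hp.le (.cons h q)
  rw [walkWeight_cons, add_comm] at this
  exact this.trans (by gcongr)

theorem Clean.not_enabled [Finite V] (hm : Clean γ) {u : N.NonRoot}
    {p : N.graph.Walk (u : V) N.root} (hp : N.IsShortestPath p) (hu : Exact γ p) :
    ¬ Enabled γ u := by
  rintro ⟨R, hR⟩
  cases R with
  | RC =>
    obtain ⟨-, v, hv, hC, hlt⟩ := hR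
    rw [hu.2] at hlt
    exact absurd (hm.walkWeight_le hp hv hC) (not_le.2 hlt)
  | REB => exact hm.1.1.not_guard_REB hu.1 u.2 hR.2.2
  | REF => exact hm.1.2 _ hR.1
  | RI => exact hm.2 _ hR.1.1
  | RR =>
    rcases hR.1 with h | h
    · exact hm.2 _ h.1
    · rw [hu.1] at h
      cases h

theorem Exact.of_step [Finite V] {u : V} {p : N.graph.Walk u N.root} (hu : Exact γ p)
    (hm : Clean γ) (hp : N.IsShortestPath p) (h : Step γ X γ') : Exact γ' p := by
  by_cases hr : u = N.root
  · subst hr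
    exact ⟨st_root, by rw [dst_root, ← hu.2, dst_root]⟩
  · have hX : (⟨u, hr⟩ : N.NonRoot) ∉ X := fun hX => by
      obtain ⟨R, hR, -⟩ := h.2.1 _ hX
      exact hm.not_enabled (u := ⟨u, hr⟩) hp hu ⟨R, hR⟩
    obtain ⟨h₁, -, h₂⟩ := h.eq_of_notMem hX
    exact ⟨h₁.trans hu.1, h₂.trans hu.2⟩

/-- The configuration is clean and the processes at hop-distance at most `m` from the root know
their exact distance. -/
def ExactUpTo (m : ℕ) (γ : N.Config) : Prop :=
  Clean γ ∧ ∀ (u : V) (p : N.graph.Walk u N.root), N.IsShortestPath p → p.length ≤ m → Exact γ p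

theorem ExactUpTo.of_step [Finite V] {m : ℕ} (hm : ExactUpTo m γ) (h : Step γ X γ') :
    ExactUpTo m γ' :=
  ⟨hm.1.of_step h, fun u p hp hl => (hm.2 u p hp hl).of_step hm.1 hp h⟩

theorem Clean.exactUpTo_zero (hm : Clean γ) : ExactUpTo 0 γ := by
  refine ⟨hm, fun u p _ hl => ?_⟩
  cases p with
  | nil => exact ⟨st_root, by simp [walkWeight]⟩
  | cons h p => simp at hl

theorem ExactUpTo.of_isRound [Finite V] {e : Execution N} {m i j : ℕ} (hr : e.IsRound i j)
    (hm : ExactUpTo m (e.conf i)) : ExactUpTo (m + 1) (e.conf j) := by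
  have hj := Execution.invariant (P := ExactUpTo m) (fun _ _ _ h hm => hm.of_step h) hm hr.1 hr.2.1
  refine ⟨hj.1, fun u p hp hl => ?_⟩
  cases p with
  | nil => exact hj.2 _ _ hp (by simp)
  | @cons _ v _ h p =>
    by_cases hu : u = N.root
    · subst hu
      simpa using hp.1
    by_contra hn
    have hv : ∀ γ : N.Config, ExactUpTo m γ → Exact γ p := fun γ hm =>
      hm.2 v p hp.of_cons (by simpa using hl)
    refine hr.not_of_backward ⟨u, hu⟩ (P := ExactUpTo m)
      (Q := fun γ => ¬ Exact γ (.cons h p)) hm (fun _ _ _ h hm => hm.of_step h) ?_ ?_ hn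
    · intro γ X γ' hs hm hn
      refine ⟨fun he => hn (he.of_step hm.1 hp hs), fun hX => hn ?_⟩
      obtain ⟨hC, hd⟩ := hv γ hm
      rcases hs.computes_or_switches hX with ⟨w, hc⟩ | ⟨hsw, -⟩
      · refine ⟨hc.st_new, hc.dst_new.trans (le_antisymm ?_ ?_)⟩
        -- The next process `v` on the shortest path is exact, so the computed minimum is at most
        -- the true distance; the other inequality holds for every neighbor of status `C`.
        · refine (hc.min v h hC).trans_eq ?_
          rw [hd, walkWeight_cons, add_comm]
        · exact hm.1.walkWeight_le hp hc.adj hc.st_eq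
      · cases hsw with
        | toEB h₁ _ h₂ => exact absurd h₂ (hm.1.1.1.not_guard_REB h₁ hu)
        | toEF h => exact absurd h (hm.1.1.2 _)
        | toI h => exact absurd h.1 (hm.1.2 _)
    · intro γ hm hn
      obtain ⟨hC, hd⟩ := hv γ hm
      have h₁ := hm.1.1.2 u
      have h₂ := hm.1.2 u
      cases hx : st γ u with
      | I => exact ⟨.RR, Or.inr hx, v, h, hC⟩
      | C =>
        refine ⟨.RC, hx, v, h, hC, ?_⟩
        obtain ⟨q, hq⟩ := hm.1.exists_walk hx
        have hle := (hp.le q).trans hq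
        have hne : dst γ u ≠ N.walkWeight (.cons h p) := fun h' => hn ⟨hx, h'⟩
        have hlt := lt_of_le_of_ne hle hne.symm
        rwa [walkWeight_cons, add_comm, ← hd] at hlt
      | EB => exact absurd hx h₁
      | EF => exact absurd hx h₂

theorem ExactUpTo.terminal [Finite V] (hm : ExactUpTo N.hopDiam γ) : Terminal γ := by
  have key : ∀ v, N.graph.Reachable v N.root →
      ∃ p : N.graph.Walk v N.root, N.IsShortestPath p ∧ Exact γ p := fun v hv => by
    obtain ⟨p, hp, hl⟩ := exists_isShortestPath hv
    exact ⟨p, hp, hm.2 v p hp (hl.trans_le (hopDist_le_hopDiam hv))⟩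
  intro u hu
  by_cases hr : N.graph.Reachable (u : V) N.root
  · obtain ⟨p, hp, he⟩ := key u hr
    exact hm.1.not_enabled hp he hu
  -- Outside the component of the root no process can have status `C`, so all are `I` without any
  -- `C` neighbor to wake them.
  · have hC : st γ u ≠ Status.C := fun hC => by
      obtain ⟨p, -⟩ := hm.1.exists_walk hC
      exact hr ⟨p⟩
    obtain ⟨R, hR⟩ := hu
    cases R with
    | RC => exact hC hR.1
    | REB => exact hC hR.1
    | REF => exact hm.1.1.2 _ hR.1
    | RI => exact hm.1.2 _ hR.1.1
    | RR =>
      obtain ⟨-, v, hv, hvC⟩ := hR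
      obtain ⟨p, -⟩ := hm.1.exists_walk hvC
      exact hr (hv.reachable.trans ⟨p⟩)

theorem Execution.RoundsEndAt.terminal [Finite V] {e : Execution N} {i : ℕ}
    (h : e.RoundsEndAt (3 * N.nMaxCC + N.hopDiam) i) : Terminal (e.conf i) := by
  have h₁ : ∀ i, e.RoundsEndAt N.nMaxCC i → NoAbnormalC (e.conf i) := fun i hi =>
    (RoundsEndAt.phase (P := NoShallowC) (a := 0)
      -- The phase starts for free: depths begin at 1, so level 0 is empty.
      (fun _ _ k u hk hu => absurd hu.pos (by omega)) (fun _ _ _ hr hm => hm.of_isRound hr)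
      (by rwa [Nat.zero_add])).noAbnormalC
  have h₂ : ∀ i, e.RoundsEndAt (N.nMaxCC + N.nMaxCC) i → NoAlive (e.conf i) := fun i hi =>
    (RoundsEndAt.phase (P := EBBound) (fun i hi => ⟨h₁ i hi, fun _ _ hu _ => hu.le_nMaxCC⟩)
      (fun _ _ _ hr hm => hm.of_isRound hr) hi).noAlive
  have h₃ : ∀ i, e.RoundsEndAt (N.nMaxCC + N.nMaxCC + N.nMaxCC) i → Clean (e.conf i) :=
    fun i hi =>
      (RoundsEndAt.phase (P := EFBound) (fun i hi => ⟨h₂ i hi, fun _ _ hu _ => hu.le_nMaxCC⟩)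
        (fun _ _ _ hr hm => hm.of_isRound hr) hi).clean
  refine (RoundsEndAt.phase (P := ExactUpTo) (fun i hi => (h₃ i hi).exactUpTo_zero)
    (fun _ _ _ hr hm => hm.of_isRound hr) ?_).terminal
  convert h using 1
  omega

end Network

end RSP

theorem mainTheorem2 {V Lbl : Type*} [Finite V] (N : RSP.Network V Lbl)
    (e : RSP.Network.Execution N) :
    e.LastsAtMostRounds (3 * N.nMaxCC + N.hopDiam) := by
  obtain ⟨L, hL⟩ := e.exists_len_eq
  exact RSP.Network.Execution.lastsAtMostRounds_of_terminal hL fun _ h => h.terminal
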